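/- Let $G$ be a finite simple graph with no isolated vertex, and let $r \ge 0$ be an integer. For a vertex $x$, let $N[x]$ denote the set consisting of $x$ and all its neighbours, and let $G - N[x]$ be the subgraph of $G$ induced by the vertices outside $N[x]$. For a graph $H$, let $\nu(H)$ be the maximum number of edges in a matching of $H$ (with $\nu(H)=0$ if $H$ has no edges), and let $e(H)$ be the number of edges of $H$. Suppose that $$\deg(x) + \nu\bigl(G - N[x]\bigr) \le r \quad\text{for every vertex } x \text{ of } G.$$ Then $e(G) \le r^2$. Moreover, $e(G) = r^2$ if and only if $G$ is isomorphic to the complete bipartite graph $K_{r,r}$. -/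

import Mathlib

namespace SimpleGraph

/-- The matching number `ν(G)`: the maximum number of edges of a matching of `G`, that is, of a
subgraph of `G` in which every vertex has exactly one neighbour (the empty matching is allowed, so
that an edgeless graph has matching number `0`). It is used for finite graphs only, where the
maximum exists, see `isGreatest_matchingNumber`. -/
noncomputable def matchingNumber {V : Type*} (G : SimpleGraph V) : ℕ :=
  sSup {n : ℕ | ∃ M : G.Subgraph, M.IsMatching ∧ M.edgeSet.ncard = n}

/-- On a finite vertex set the supremum in `matchingNumber` is an attained maximum. -/
theorem isGreatest_matchingNumber {V : Type*} [Finite V] (G : SimpleGraph V) :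
    IsGreatest {n : ℕ | ∃ M : G.Subgraph, M.IsMatching ∧ M.edgeSet.ncard = n}
      G.matchingNumber := by
  have hne : {n : ℕ | ∃ M : G.Subgraph, M.IsMatching ∧ M.edgeSet.ncard = n}.Nonempty :=
    ⟨0, ⊥, by intro v hv; simp at hv, by simp⟩
  have hbdd : BddAbove {n : ℕ | ∃ M : G.Subgraph, M.IsMatching ∧ M.edgeSet.ncard = n} := by
    refine ⟨G.edgeSet.ncard, ?_⟩
    rintro n ⟨M, -, rfl⟩
    exact Set.ncard_le_ncard M.edgeSet_subset (Set.toFinite _)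
  exact ⟨Nat.sSup_mem hne hbdd, fun n hn => le_csSup hbdd hn⟩

end SimpleGraph

/-!
Let `x` be a vertex of maximum degree `d ≤ r`, and put `H = G - N[x]`. Every edge of `G` either
meets `N(x)`, and there are at most `d * d` such edges, or lies in `H`
(`SimpleGraph.card_edgeFinset_le_card_edgesMeeting_add`). The edges of `H` all touch a maximum
matching of `H`, and an edge of that matching is touched by at most `2d - 1` edges, so
`e(H) ≤ ν(H) (2d - 1)` (`SimpleGraph.card_edgeFinset_le_matchingNumber_mul`). Since
`ν(H) ≤ r - d`, this gives `e(G) ≤ d² + (r - d)(2d - 1) ≤ r² - (r - d)`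
(`SimpleGraph.card_edgeFinset_add_le`).

If `e(G) = r²`, then `d = r` and the estimate is tight at every vertex `x` of degree `r`: the graph
`H` is edgeless, `N(x)` is independent, and all neighbours of `x` have degree `r`
(`SimpleGraph.extremal_of_degree_eq`). So a vertex outside `N(x)` has neighbours in `N(x)` only;
it has at least one, since it is not isolated, and tightness at that neighbour shows that it has
degree `r`, hence is joined to all of `N(x)`. Thus `G` is complete bipartite between `N(x)` and its
complement, which is the neighbourhood of any vertex of `N(x)` and so also has `r` elements.
-/

namespace SimpleGraph

/-! ### Recognising and counting `K_{r,r}` -/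

/-- If `s` and its complement both have `r` elements, and adjacency means lying on different sides
of `s`, then the graph is `K_{r,r}`. -/
theorem nonempty_iso_completeBipartiteGraph {V : Type*} [Fintype V]
    [DecidableEq V] {G : SimpleGraph V} {r : ℕ} {s : Finset V} (hs : s.card = r)
    (hsc : sᶜ.card = r) (hadj : ∀ u v, G.Adj u v ↔ ¬ (u ∈ s ↔ v ∈ s)) :
    Nonempty (G ≃g completeBipartiteGraph (Fin r) (Fin r)) := by
  let e₁ : {v // v ∈ s} ≃ Fin r := Fintype.equivFinOfCardEq (by simpa using hs)
  let e₂ : {v // v ∉ s} ≃ Fin r := Fintype.equivFinOfCardEq (by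
    rw [Fintype.card_subtype_compl, Fintype.card_coe, ← Finset.card_compl, hsc])
  refine ⟨Iso.symm ⟨(Equiv.sumCongr e₁ e₂).symm.trans (Equiv.sumCompl (· ∈ s)), ?_⟩⟩
  intro a b
  rcases a with a | a <;> rcases b with b | b <;>
    simp [hadj, (e₁.symm _).2, (e₂.symm _).2]

theorem card_edgeFinset_of_iso_completeBipartiteGraph {V : Type*} [Fintype V]
    {G : SimpleGraph V} [DecidableRel G.Adj] {r : ℕ}
    (e : G ≃g completeBipartiteGraph (Fin r) (Fin r)) : G.edgeFinset.card = r ^ 2 := by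
  classical
  rw [e.card_edgeFinset_eq]
  have h := encard_edgeSet_completeBipartiteGraph (W₁ := Fin r) (W₂ := Fin r)
  rw [← coe_edgeFinset, Set.encard_coe_eq_coe_finsetCard] at h
  simp only [ENat.card_eq_coe_fintype_card, Fintype.card_fin] at h
  rw [sq]
  exact_mod_cast h

/-! ### Edges meeting a set of vertices, and matchings -/

/-- A maximum matching is maximal for inclusion: its vertices cover all edges. -/
theorem exists_isMatching_ncard_eq_matchingNumber {V : Type*} [Finite V]
    (G : SimpleGraph V) :
    ∃ M : G.Subgraph, M.IsMatching ∧ M.edgeSet.ncard = G.matchingNumber ∧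
      ∀ u v, G.Adj u v → u ∈ M.verts ∨ v ∈ M.verts := by
  obtain ⟨⟨M, hM, hcard⟩, hmax⟩ := G.isGreatest_matchingNumber
  refine ⟨M, hM, hcard, fun u v huv => ?_⟩
  by_contra! hcon
  have hM' : (M ⊔ G.subgraphOfAdj huv).IsMatching := by
    refine hM.sup (Subgraph.IsMatching.subgraphOfAdj huv) ?_
    rw [hM.support_eq_verts, support_subgraphOfAdj, Set.disjoint_left]
    rintro w hw (rfl | rfl)
    exacts [hcon.1 hw, hcon.2 hw]
  have hnot : s(u, v) ∉ M.edgeSet := fun h => hcon.1 (M.edge_vert (Subgraph.mem_edgeSet.1 h))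
  have h := hmax ⟨_, hM', rfl⟩
  rw [Subgraph.edgeSet_sup, edgeSet_subgraphOfAdj, Set.union_singleton,
    Set.ncard_insert_of_notMem hnot, hcard] at h
  omega

variable {V : Type*} [Fintype V] [DecidableEq V] (G : SimpleGraph V) [DecidableRel G.Adj]

/-- The edges of `G` having at least one endpoint in `s`, presented as a union of stars so that
they can be counted by degrees. -/
def edgesMeeting (s : Finset V) : Finset (Sym2 V) :=
  s.biUnion fun v => G.incidenceFinset v

variable {G} in
theorem mem_edgesMeeting {s : Finset V} {e : Sym2 V} :
    e ∈ G.edgesMeeting s ↔ e ∈ G.edgeSet ∧ ∃ v ∈ s, v ∈ e := by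
  simp only [edgesMeeting, Finset.mem_biUnion, mem_incidenceFinset, incidenceSet,
    Set.mem_ofPred_eq]
  tauto

/-- The inequality is strict because the edge `uv` is incident to both `u` and `v`. -/
theorem card_incidenceFinset_union_lt {u v : V} (h : G.Adj u v) :
    (G.incidenceFinset u ∪ G.incidenceFinset v).card < G.degree u + G.degree v := by
  rw [← card_incidenceFinset_eq_degree, ← card_incidenceFinset_eq_degree,
    ← Finset.card_union_add_card_inter]
  refine Nat.lt_add_of_pos_right (Finset.card_pos.2 ⟨s(u, v), ?_⟩)
  simp [incidenceSet, h]

/-- Every edge shares an endpoint with an edge of a maximum matching, and at most `2Δ - 1` edges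
share an endpoint with a given edge, that edge included. The truncated subtraction at `Δ = 0` is
harmless, since then there are no edges. -/
theorem card_edgeFinset_le_matchingNumber_mul :
    G.edgeFinset.card ≤ G.matchingNumber * (2 * G.maxDegree - 1) := by
  classical
  obtain ⟨M, hM, hcard, hcov⟩ := G.exists_isMatching_ncard_eq_matchingNumber
  have hsub : G.edgeFinset ⊆ M.edgeSet.toFinset.biUnion
      fun e => {f ∈ G.edgeFinset | ∃ w ∈ e, w ∈ f} := by
    intro f hf
    have hw : ∃ w ∈ f, w ∈ M.verts := by
      induction f with
      | h u v =>
        rcases hcov u v (by simpa using hf) with h | h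
        exacts [⟨u, by simp, h⟩, ⟨v, by simp, h⟩]
    obtain ⟨w, hwf, hwM⟩ := hw
    obtain ⟨w', hw', -⟩ := hM hwM
    refine Finset.mem_biUnion.2 ⟨s(w, w'), by simpa using hw', Finset.mem_filter.2 ⟨hf, w, ?_⟩⟩
    simpa using hwf
  rw [← hcard, Set.ncard_eq_toFinset_card']
  refine (Finset.card_le_card hsub).trans (Finset.card_biUnion_le_card_mul _ _ _ fun e he => ?_)
  induction e with
  | h u v =>
    have huv : G.Adj u v := M.adj_sub (by simpa using he)
    have h : ({f ∈ G.edgeFinset | ∃ w ∈ s(u, v), w ∈ f} : Finset _) ⊆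
        G.incidenceFinset u ∪ G.incidenceFinset v := by
      intro f
      simp only [Finset.mem_filter, mem_edgeFinset, Sym2.mem_iff, Finset.mem_union,
        mem_incidenceFinset, incidenceSet]
      rintro ⟨hf, w, rfl | rfl, hw⟩
      exacts [Or.inl ⟨hf, hw⟩, Or.inr ⟨hf, hw⟩]
    have h1 := Finset.card_le_card h
    have h2 := G.card_incidenceFinset_union_lt huv
    have h3 := G.degree_le_maxDegree u
    have h4 := G.degree_le_maxDegree v
    omega

/-- An edge that does not meet `N(x)` avoids `x` as well, so it is an edge of `G - N[x]`. -/
theorem card_edgeFinset_le_card_edgesMeeting_add (x : V) :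
    G.edgeFinset.card ≤ (G.edgesMeeting (G.neighborFinset x)).card +
      (G.induce (insert x (G.neighborSet x))ᶜ).edgeFinset.card := by
  have hsub : G.edgeFinset ⊆ G.edgesMeeting (G.neighborFinset x) ∪
      (G.induce (insert x (G.neighborSet x))ᶜ).edgeFinset.map
        (Function.Embedding.subtype _).sym2Map := by
    intro e he
    rw [map_edgeFinset_induce]
    induction e with
    | h u v =>
      have huv : G.Adj u v := by simpa using he
      simp only [Finset.mem_union, mem_edgesMeeting, mem_neighborFinset,
        Finset.mem_inter, Finset.mk_mem_sym2_iff, Set.mem_toFinset, Set.mem_compl_iff,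
        Set.mem_insert_iff, mem_neighborSet, mem_edgeFinset, mem_edgeSet]
      by_cases hu : G.Adj x u
      · exact Or.inl ⟨huv, u, hu, by simp⟩
      by_cases hv : G.Adj x v
      · exact Or.inl ⟨huv, v, hv, by simp⟩
      refine Or.inr ⟨huv, ?_, ?_⟩
      · rintro (rfl | h)
        exacts [hv huv, hu h]
      · rintro (rfl | h)
        exacts [hu huv.symm, hv h]
  refine (Finset.card_le_card hsub).trans ((Finset.card_union_le _ _).trans ?_)
  rw [Finset.card_map]

theorem card_edgesMeeting_le (s : Finset V) :
    (G.edgesMeeting s).card ≤ s.card * G.maxDegree :=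
  Finset.card_biUnion_le_card_mul _ _ _ fun y _ => by
    rw [card_incidenceFinset_eq_degree]
    exact G.degree_le_maxDegree y

variable {G}

theorem degree_eq_of_card_edgesMeeting_eq {s : Finset V}
    (h : (G.edgesMeeting s).card = s.card * G.maxDegree) {y : V} (hy : y ∈ s) :
    G.degree y = G.maxDegree := by
  by_contra hne
  have hlt : ∑ v ∈ s, G.degree v < ∑ _v ∈ s, G.maxDegree :=
    Finset.sum_lt_sum (fun v _ => G.degree_le_maxDegree v)
      ⟨y, hy, lt_of_le_of_ne (G.degree_le_maxDegree y) hne⟩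
  have hle : (G.edgesMeeting s).card ≤ ∑ v ∈ s, G.degree v := by
    simpa only [edgesMeeting, card_incidenceFinset_eq_degree] using
      Finset.card_biUnion_le (s := s) (t := fun v => G.incidenceFinset v)
  simp only [Finset.sum_const, smul_eq_mul] at hlt
  omega

theorem not_adj_of_card_edgesMeeting_eq {s : Finset V}
    (h : (G.edgesMeeting s).card = s.card * G.maxDegree) {y z : V} (hy : y ∈ s)
    (hz : z ∈ s) : ¬ G.Adj y z := by
  intro hyz
  -- Count the stars at `y` and `z` together: the shared edge `yz` costs one in the bound.
  have hsub : G.edgesMeeting s ⊆ G.edgesMeeting ((s.erase y).erase z) ∪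
      (G.incidenceFinset y ∪ G.incidenceFinset z) := by
    intro e
    simp only [edgesMeeting, Finset.mem_biUnion, Finset.mem_union, Finset.mem_erase]
    rintro ⟨w, hw, he⟩
    by_cases hwy : w = y
    · exact Or.inr (Or.inl (hwy ▸ he))
    by_cases hwz : w = z
    · exact Or.inr (Or.inr (hwz ▸ he))
    exact Or.inl ⟨w, ⟨hwz, hwy, hw⟩, he⟩
  have hz' : z ∈ s.erase y := Finset.mem_erase.2 ⟨hyz.ne', hz⟩
  have hs : s.card = ((s.erase y).erase z).card + 2 := by
    rw [← Finset.card_erase_add_one hy, ← Finset.card_erase_add_one hz']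
  have h1 := (Finset.card_le_card hsub).trans (Finset.card_union_le _ _)
  have h2 := G.card_edgesMeeting_le ((s.erase y).erase z)
  have h3 := G.card_incidenceFinset_union_lt hyz
  have h4 := G.degree_le_maxDegree y
  have h5 := G.degree_le_maxDegree z
  rw [h, hs, add_mul] at h1
  omega

/-! ### The bound and its equality case -/

variable (G) in
/-- With `d` the maximum degree, the count is `d² + (r - d)(2d - 1) = r² - (r - d)² - (r - d)`
at most; the slack `r - d` is kept because it forces `d = r` in the equality case. -/
theorem card_edgeFinset_add_le {r : ℕ} {x : V} (hx : G.degree x = G.maxDegree)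
    (hpos : 0 < G.maxDegree)
    (hr : G.degree x + (G.induce (insert x (G.neighborSet x))ᶜ).matchingNumber ≤ r) :
    G.edgeFinset.card + (r - G.maxDegree) ≤ r ^ 2 := by
  have h1 := G.card_edgeFinset_le_card_edgesMeeting_add x
  have h2 := G.card_edgesMeeting_le (G.neighborFinset x)
  have h3 := (G.induce (insert x (G.neighborSet x))ᶜ).card_edgeFinset_le_matchingNumber_mul
  have h4 : (G.induce (insert x (G.neighborSet x))ᶜ).maxDegree ≤ G.maxDegree :=
    Copy.maxDegree_mono (Embedding.induce _).toCopy
  rw [card_neighborFinset_eq_degree] at h2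
  rw [hx] at h2 hr
  generalize (G.induce (insert x (G.neighborSet x))ᶜ).matchingNumber = ν at *
  generalize (G.induce (insert x (G.neighborSet x))ᶜ).maxDegree = d' at *
  generalize G.maxDegree = d at *
  obtain ⟨k, rfl⟩ := Nat.exists_eq_add_of_le ((Nat.le_add_right d ν).trans hr)
  have h5 : ν * (2 * d' - 1) ≤ k * (2 * d - 1) := Nat.mul_le_mul (by omega) (by omega)
  have h6 : k * (2 * d - 1) + k = k * (2 * d) := by
    rw [← Nat.mul_succ]; congr 1; omega
  have h7 : (d + k) ^ 2 = d * d + k * (2 * d) + k * k := by ring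
  omega

/-- The local structure around a vertex `x` of maximum degree `d` when `G` has `d²` edges and
`G - N[x]` is edgeless: the `d` stars at the neighbours of `x` have to be disjoint and of size `d`,
and to contain all edges. -/
theorem extremal_of_degree_eq {x : V} (hx : G.degree x = G.maxDegree)
    (hν : (G.induce (insert x (G.neighborSet x))ᶜ).matchingNumber = 0)
    (he : G.edgeFinset.card = G.maxDegree ^ 2) :
    (∀ y, G.Adj x y → G.degree y = G.maxDegree) ∧
      (∀ y z, G.Adj x y → G.Adj x z → ¬ G.Adj y z) ∧
      ∀ y z, G.Adj y z → G.Adj x y ∨ G.Adj x z := by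
  have h1 := G.card_edgeFinset_le_card_edgesMeeting_add x
  have h2 := G.card_edgesMeeting_le (G.neighborFinset x)
  have h3 := (G.induce (insert x (G.neighborSet x))ᶜ).card_edgeFinset_le_matchingNumber_mul
  rw [hν, zero_mul] at h3
  have h4 : (G.neighborFinset x).card * G.maxDegree = G.maxDegree ^ 2 := by
    rw [card_neighborFinset_eq_degree, hx, sq]
  have h5 : (G.edgesMeeting (G.neighborFinset x)).card =
      (G.neighborFinset x).card * G.maxDegree := by omega
  refine ⟨fun y hy => degree_eq_of_card_edgesMeeting_eq h5 (by simpa using hy),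
    fun y z hy hz => not_adj_of_card_edgesMeeting_eq h5 (by simpa using hy)
      (by simpa using hz), fun y z hyz => ?_⟩
  have hsub : G.edgesMeeting (G.neighborFinset x) ⊆ G.edgeFinset := fun e he' =>
    mem_edgeFinset.2 (mem_edgesMeeting.1 he').1
  have heq := Finset.eq_of_subset_of_card_le hsub (by omega)
  have hmem : s(y, z) ∈ G.edgesMeeting (G.neighborFinset x) := by
    rw [heq]; simpa using hyz
  obtain ⟨-, w, hw, hwe⟩ := mem_edgesMeeting.1 hmem
  rw [mem_neighborFinset] at hw
  rcases Sym2.mem_iff.1 hwe with rfl | rfl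
  exacts [Or.inl hw, Or.inr hw]

/-- The two sides of `K_{d,d}` are `N(x)` and its complement, where `x` has maximum degree `d`. -/
theorem nonempty_iso_completeBipartiteGraph_of_card_edgeFinset_eq {x : V}
    (hiso : ∀ x : V, ¬ G.IsIsolated x)
    (hx : G.degree x = G.maxDegree)
    (hr : ∀ x : V,
      G.degree x + (G.induce (insert x (G.neighborSet x))ᶜ).matchingNumber ≤ G.maxDegree)
    (he : G.edgeFinset.card = G.maxDegree ^ 2) :
    Nonempty (G ≃g completeBipartiteGraph (Fin G.maxDegree) (Fin G.maxDegree)) := by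
  have key : ∀ v, G.degree v = G.maxDegree → (∀ y, G.Adj v y → G.degree y = G.maxDegree) ∧
      (∀ y z, G.Adj v y → G.Adj v z → ¬ G.Adj y z) ∧
      ∀ y z, G.Adj y z → G.Adj v y ∨ G.Adj v z := fun v hv =>
    extremal_of_degree_eq hv (by have := hr v; omega) he
  obtain ⟨hdeg, hind, hcov⟩ := key x hx
  -- A vertex `z` outside `N(x)` has all its neighbours in `N(x)`. Any such neighbour has maximum
  -- degree, so the structure around it forces `z` to have maximum degree too.
  have hfull : ∀ z, ¬ G.Adj x z → G.neighborFinset z = G.neighborFinset x := by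
    intro z hz
    have hsub : G.neighborFinset z ⊆ G.neighborFinset x := by
      intro w hw
      rw [mem_neighborFinset] at hw ⊢
      exact (hcov z w hw).resolve_left hz
    obtain ⟨y, hy⟩ := exists_adj_iff_not_isIsolated.2 (hiso z)
    have hxy : G.Adj x y := by simpa using hsub (by simpa using hy)
    refine Finset.eq_of_subset_of_card_le hsub ?_
    rw [card_neighborFinset_eq_degree, card_neighborFinset_eq_degree, hx,
      (key y (hdeg y hxy)).1 z hy.symm]
  have hfull' : ∀ z w, ¬ G.Adj x z → (G.Adj z w ↔ G.Adj x w) := fun z w hz => by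
    rw [← mem_neighborFinset, hfull z hz, mem_neighborFinset]
  have hadj : ∀ u v, G.Adj u v ↔ ¬ (u ∈ G.neighborFinset x ↔ v ∈ G.neighborFinset x) := by
    intro u v
    simp only [mem_neighborFinset]
    by_cases hu : G.Adj x u
    · by_cases hv : G.Adj x v
      · simp [hu, hv, hind u v hu hv]
      · simp [hu, hv, G.adj_comm u v, hfull' v u hv]
    · simp [hu, hfull' u v hu]
  obtain ⟨y, hy⟩ := exists_adj_iff_not_isIsolated.2 (hiso x)
  have hcompl : (G.neighborFinset x)ᶜ = G.neighborFinset y := by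
    ext z
    have hy' : y ∈ G.neighborFinset x := by simpa using hy
    rw [Finset.mem_compl, G.mem_neighborFinset y z, hadj y z]
    simp [hy]
  refine nonempty_iso_completeBipartiteGraph ?_ ?_ hadj
  · rw [card_neighborFinset_eq_degree, hx]
  · rw [hcompl, card_neighborFinset_eq_degree, hdeg y hy]

end SimpleGraph

theorem lemma2p4 {V : Type*} [Fintype V] [DecidableEq V] (G : SimpleGraph V)
    [DecidableRel G.Adj] (r : ℕ)
    (hiso : ∀ x : V, ¬ G.IsIsolated x)
    (hr : ∀ x : V,
      G.degree x + (G.induce (insert x (G.neighborSet x))ᶜ).matchingNumber ≤ r) :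
    G.edgeFinset.card ≤ r ^ 2 ∧
      (G.edgeFinset.card = r ^ 2 ↔
        Nonempty (G ≃g completeBipartiteGraph (Fin r) (Fin r))) := by
  rcases isEmpty_or_nonempty V with hV | hV
  · have he : G.edgeFinset.card = 0 := by
      rw [Finset.card_eq_zero, Finset.eq_empty_iff_forall_notMem]
      intro e
      induction e with
      | h u v => exact isEmptyElim u
    refine ⟨by omega, fun h => ?_, fun ⟨e⟩ =>
      SimpleGraph.card_edgeFinset_of_iso_completeBipartiteGraph e⟩
    obtain rfl : r = 0 := by
      rw [he] at h
      exact pow_eq_zero_iff two_ne_zero |>.1 h.symm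
    exact SimpleGraph.nonempty_iso_completeBipartiteGraph (s := ∅) rfl (by simp)
      fun u => isEmptyElim u
  · obtain ⟨x, hx⟩ := G.exists_maximal_degree_vertex
    have hpos : 0 < G.maxDegree := hx ▸ (G.degree_pos x).2 (hiso x)
    have hle := G.card_edgeFinset_add_le hx.symm hpos (hr x)
    refine ⟨by omega, fun h => ?_, fun ⟨e⟩ =>
      SimpleGraph.card_edgeFinset_of_iso_completeBipartiteGraph e⟩
    obtain rfl : r = G.maxDegree := by
      have := hr x
      omega
    exact SimpleGraph.nonempty_iso_completeBipartiteGraph_of_card_edgeFinset_eq hiso hx.symm hr h
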